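/- **Setting.** There are $n$ men $M$ and $n$ women $W$; each agent $i$ has a strict total order $\succ_i$ (true preferences) over the agents of the other side. A matching is a bijection between $M$ and $W$; $\mu(i)$ is the partner of $i$. It is stable if there is no pair $(m,w)$ with $w \succ_m \mu(m)$ and $m \succ_w \mu(w)$. A strategy profile $\mathbf p=(\mathbf p_m)_{m\in M}$ is a list of reported strict total orders of the men over $W$; the women report truthfully. $\mathrm{DA}(\mathbf p)$ is the matching produced by men-proposing deferred acceptance (in each round every unmatched man proposes to his favourite woman who has not yet rejected him, and every woman keeps her favourite proposer and rejects the others, until no more proposals are possible). Let $P\subseteq M\times W$ be a set of strategic pairs. At a profile $\mathbf p$, a report $\mathbf p'_m$ is an *accomplice manipulation* by $(m,w)\in P$ if, for $\mu=\mathrm{DA}(\mathbf p)$ and $\mu'=\mathrm{DA}(\mathbf p_{-m},\mathbf p'_m)$, one has $\mu'(w)\succ_w\mu(w)$ and $\mu'(m)\succeq_m\mu(m)$ (true preferences). The profile $\mathbf p$ is a *Nash equilibrium* (NE) if no pair in $P$ has an accomplice manipulation at $\mathbf p$. The report $\mathbf p'_m$ is a *push-up* of $m$ at $\mathbf p$ if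 there is a set $X\subseteq W$ such that the set of women above $\mu(m)$ in $\mathbf p'_m$ is $L\cup X$ and the set below is $R\setminus X$, where $L$ and $R$ are the sets of women above and below $\mu(m)$ in $\mathbf p_m$ (the order within each of the two parts is arbitrary). A *realization of the push-up dynamics* is a sequence $\mathbf p^{(1)},\mathbf p^{(2)},\dots$ with $\mathbf p^{(1)}=\,\succ$ (the men's true preferences) in which $\mathbf p^{(t+1)}$ results from a push-up accomplice manipulation at $\mathbf p^{(t)}$ by some pair in $P$ if there is one, and $\mathbf p^{(t+1)}=\mathbf p^{(t)}$ otherwise; it *converges* to $\mathbf p^{(t)}$ if no pair in $P$ has a push-up accomplice manipulation at $\mathbf p^{(t)}$. **Proposition.** Different realizations of the push-up dynamics of the same instance may converge to different Nash equilibria that correspond to distinct stable matchings. Explicitly, let $n=30$, $P=M\times W$, and let the true preferences (most preferred first) be as listed below. Then there are two realizations of the push-up dynamics that converge to profiles $\mathbf p$ and $\mathbf q$, respectively, such that $\mathbf p$ and $\mathbf q$ are Nash equilibria, $\mathbf p\ne\mathbf q$, the matchings $\mathrm{DA}(\mathbf p)$ and $\mathrm{DA}(\mathbf q)$ are both stable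 with respect to the true preferences, and $\mathrm{DA}(\mathbf p)\neq\mathrm{DA}(\mathbf q)$. Men's preferences (over the women $1,\dots,30$): - $m_{1}$: 22, 18, 15, 28, 25, 3, 19, 1, 23, 20, 16, 8, 27, 2, 24, 30, 21, 9, 10, 13, 11, 14, 26, 17, 29, 12, 6, 7, 5, 4 - $m_{2}$: 25, 1, 4, 23, 3, 15, 22, 12, 26, 8, 7, 17, 9, 11, 16, 28, 19, 10, 2, 14, 5, 18, 21, 29, 30, 27, 24, 6, 20, 13 - $m_{3}$: 18, 16, 12, 13, 22, 27, 15, 30, 4, 2, 11, 23, 1, 28, 3, 24, 5, 26, 19, 29, 17, 8, 20, 10, 21, 6, 25, 9, 7, 14 - $m_{4}$: 11, 30, 19, 23, 16, 14, 17, 21, 26, 10, 28, 27, 15, 13, 8, 5, 29, 4, 22, 6, 20, 7, 1, 25, 3, 18, 12, 24, 9, 2 - $m_{5}$: 30, 16, 19, 7, 2, 27, 24, 13, 8, 6, 17, 20, 12, 9, 5, 23, 3, 1, 22, 25, 26, 4, 15, 11, 10, 18, 21, 29, 14, 28 - $m_{6}$: 18, 17, 24, 7, 25, 29, 27, 28,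 14, 10, 5, 19, 9, 4, 6, 20, 23, 3, 13, 16, 2, 12, 1, 26, 30, 15, 11, 22, 8, 21 - $m_{7}$: 28, 6, 7, 18, 3, 10, 17, 21, 19, 22, 5, 12, 30, 9, 14, 13, 20, 1, 23, 24, 27, 11, 29, 26, 25, 4, 15, 2, 8, 16 - $m_{8}$: 15, 7, 14, 5, 28, 27, 20, 2, 22, 1, 6, 18, 24, 29, 21, 3, 9, 17, 23, 19, 4, 10, 30, 25, 26, 13, 8, 12, 11, 16 - $m_{9}$: 14, 4, 19, 17, 29, 24, 30, 8, 12, 27, 2, 6, 9, 1, 20, 15, 3, 16, 18, 11, 13, 22, 21, 25, 23, 5, 26, 7, 28, 10 - $m_{10}$: 7, 28, 2, 19, 22, 4, 29, 24, 15, 17, 25, 23, 5, 6, 1, 21, 13, 11, 10, 8, 30, 9, 16, 20, 12, 3, 18, 14, 26, 27 - $m_{11}$: 8, 22, 28, 10, 1, 9, 16, 4, 14, 6, 17, 19, 24, 25, 5, 18, 13, 11, 21, 3, 30, 27, 26, 2, 23, 29, 15, 20, 7, 12 - $m_{12}$: 7, 29, 26, 9, 5, 2, 1, 15, 12, 8,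 3, 25, 16, 24, 17, 28, 14, 19, 23, 10, 4, 13, 11, 6, 18, 30, 27, 22, 21, 20 - $m_{13}$: 21, 13, 15, 8, 2, 24, 6, 12, 30, 4, 23, 7, 17, 10, 27, 20, 26, 14, 29, 19, 9, 11, 25, 18, 1, 22, 16, 5, 3, 28 - $m_{14}$: 20, 17, 23, 30, 27, 10, 3, 16, 24, 5, 25, 13, 12, 4, 1, 28, 29, 21, 22, 2, 7, 14, 8, 6, 11, 18, 19, 15, 9, 26 - $m_{15}$: 15, 25, 9, 12, 26, 20, 8, 23, 28, 11, 14, 18, 22, 5, 17, 30, 27, 3, 29, 7, 1, 13, 10, 21, 2, 24, 16, 6, 19, 4 - $m_{16}$: 16, 19, 12, 24, 5, 1, 3, 10, 22, 2, 26, 23, 14, 25, 11, 9, 15, 28, 4, 30, 7, 6, 29, 27, 8, 13, 17, 21, 18, 20 - $m_{17}$: 15, 9, 1, 29, 24, 12, 8, 7, 25, 4, 23, 6, 5, 22, 13, 17, 26, 21, 30, 11, 16, 28, 18, 19, 10, 2, 3, 14, 27, 20 - $m_{18}$: 21, 17, 9, 20, 1, 15, 6, 23, 11, 22, 29, 3,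 12, 8, 24, 5, 7, 4, 2, 26, 16, 19, 18, 27, 28, 14, 13, 30, 25, 10 - $m_{19}$: 24, 30, 16, 29, 15, 22, 23, 7, 28, 26, 14, 19, 1, 9, 11, 18, 27, 10, 17, 25, 6, 12, 2, 8, 3, 4, 20, 5, 13, 21 - $m_{20}$: 25, 29, 1, 23, 12, 27, 7, 2, 19, 30, 18, 22, 5, 13, 3, 26, 16, 4, 28, 20, 9, 17, 15, 21, 10, 11, 8, 6, 14, 24 - $m_{21}$: 21, 2, 25, 24, 26, 14, 22, 28, 20, 18, 9, 12, 8, 5, 17, 16, 23, 11, 30, 4, 15, 13, 19, 10, 7, 3, 29, 6, 1, 27 - $m_{22}$: 17, 7, 10, 29, 4, 26, 9, 5, 14, 22, 1, 18, 3, 25, 20, 28, 2, 30, 11, 13, 6, 19, 23, 12, 8, 15, 24, 21, 16, 27 - $m_{23}$: 27, 28, 29, 25, 20, 8, 7, 24, 30, 12, 17, 11, 13, 5, 22, 2, 3, 23, 26, 19, 4, 18, 10, 16, 1, 15, 21, 9, 14, 6 - $m_{24}$: 21, 29, 6, 25, 4, 12, 23, 20, 7, 22, 11, 19, 5, 2,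 24, 9, 18, 26, 16, 3, 28, 8, 27, 17, 10, 30, 1, 14, 15, 13 - $m_{25}$: 2, 30, 22, 3, 13, 1, 11, 19, 21, 17, 29, 8, 23, 26, 14, 10, 28, 6, 4, 15, 7, 16, 25, 12, 9, 24, 18, 5, 20, 27 - $m_{26}$: 20, 21, 7, 15, 2, 19, 25, 16, 29, 17, 13, 23, 10, 22, 30, 12, 18, 14, 27, 26, 3, 4, 6, 28, 11, 5, 8, 24, 9, 1 - $m_{27}$: 6, 7, 22, 13, 5, 18, 16, 17, 4, 3, 11, 12, 9, 27, 24, 30, 25, 1, 15, 10, 26, 28, 23, 20, 29, 14, 19, 2, 8, 21 - $m_{28}$: 6, 13, 28, 8, 26, 10, 9, 25, 23, 15, 2, 29, 16, 3, 17, 5, 24, 7, 1, 11, 14, 20, 27, 19, 21, 18, 22, 4, 12, 30 - $m_{29}$: 29, 17, 11, 30, 10, 13, 24, 21, 19, 25, 23, 1, 12, 27, 6, 3, 9, 4, 8, 14, 26, 18, 22, 2, 20, 28, 5, 15, 7, 16 - $m_{30}$: 2, 18, 16, 28, 5, 24, 9, 15, 30, 13, 29, 17, 22, 11, 7, 10,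 8, 19, 23, 27, 21, 20, 14, 3, 25, 1, 26, 6, 4, 12 Women's preferences (over the men $1,\dots,30$): - $w_{1}$: 21, 5, 14, 23, 4, 1, 27, 24, 13, 17, 11, 22, 2, 10, 19, 8, 3, 15, 16, 18, 6, 26, 20, 12, 29, 7, 9, 28, 25, 30 - $w_{2}$: 14, 11, 23, 26, 4, 21, 10, 28, 16, 3, 25, 5, 17, 20, 1, 27, 24, 9, 29, 12, 6, 30, 7, 13, 22, 15, 19, 8, 18, 2 - $w_{3}$: 4, 29, 27, 23, 28, 17, 8, 26, 5, 25, 6, 16, 14, 15, 1, 24, 10, 7, 13, 11, 3, 18, 22, 30, 9, 12, 2, 21, 19, 20 - $w_{4}$: 10, 13, 12, 19, 4, 11, 24, 28, 6, 23, 3, 25, 14, 17, 20, 5, 27, 15, 26, 8, 16, 18, 2, 1, 21, 7, 29, 30, 9, 22 - $w_{5}$: 17, 29, 20, 9, 10, 13, 26, 23, 22, 28, 4, 5, 21, 30, 3, 19, 27, 12, 24, 2, 7, 18, 16, 25, 1, 8, 14, 6, 11, 15 - $w_{6}$: 10, 22, 5, 1, 7, 20, 2, 30, 4, 14, 8, 26,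 16, 12, 3, 6, 9, 18, 21, 13, 29, 28, 23, 19, 11, 24, 27, 15, 25, 17 - $w_{7}$: 26, 13, 16, 8, 24, 25, 20, 4, 7, 5, 2, 14, 9, 29, 27, 18, 15, 19, 11, 1, 22, 30, 17, 12, 23, 3, 10, 6, 21, 28 - $w_{8}$: 1, 28, 15, 11, 10, 25, 8, 30, 21, 26, 16, 19, 27, 17, 23, 12, 24, 5, 20, 2, 18, 7, 6, 14, 13, 3, 22, 9, 4, 29 - $w_{9}$: 2, 27, 4, 11, 20, 6, 22, 7, 16, 5, 17, 24, 14, 26, 15, 10, 30, 13, 19, 23, 3, 21, 1, 25, 18, 28, 8, 9, 29, 12 - $w_{10}$: 30, 4, 7, 28, 3, 10, 13, 27, 20, 16, 14, 26, 5, 2, 11, 9, 24, 23, 6, 17, 19, 1, 15, 22, 25, 8, 29, 12, 18, 21 - $w_{11}$: 29, 7, 28, 23, 26, 10, 20, 21, 24, 6, 1, 18, 15, 19, 5, 11, 13, 16, 4, 17, 3, 8, 12, 14, 25, 9, 27, 22, 30, 2 - $w_{12}$: 4, 28, 9, 27, 8, 30, 1, 25, 24, 6, 2, 16, 19, 29,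 15, 13, 5, 12, 21, 3, 17, 7, 26, 11, 10, 18, 20, 23, 22, 14 - $w_{13}$: 18, 28, 5, 7, 23, 2, 24, 22, 16, 13, 10, 9, 21, 1, 14, 29, 3, 19, 6, 25, 4, 27, 17, 20, 30, 12, 8, 26, 15, 11 - $w_{14}$: 11, 14, 7, 16, 26, 19, 5, 21, 10, 12, 15, 4, 1, 22, 28, 30, 13, 17, 8, 6, 27, 2, 24, 20, 25, 3, 18, 9, 29, 23 - $w_{15}$: 23, 9, 8, 21, 22, 29, 24, 15, 14, 27, 4, 13, 10, 25, 11, 7, 28, 26, 1, 5, 16, 12, 2, 20, 6, 3, 18, 30, 17, 19 - $w_{16}$: 16, 29, 6, 5, 26, 2, 7, 3, 24, 22, 19, 8, 13, 18, 12, 15, 17, 9, 10, 25, 20, 11, 30, 28, 27, 4, 21, 1, 23, 14 - $w_{17}$: 21, 23, 2, 13, 28, 22, 27, 10, 7, 29, 8, 9, 25, 11, 24, 6, 15, 30, 17, 19, 26, 20, 18, 16, 3, 12, 4, 14, 1, 5 - $w_{18}$: 18, 24, 30, 10, 1, 14, 26, 16, 4, 7, 29, 25, 8, 5, 19, 13,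 9, 3, 23, 2, 21, 27, 17, 20, 12, 15, 6, 11, 28, 22 - $w_{19}$: 4, 19, 12, 29, 28, 30, 9, 3, 24, 7, 13, 18, 20, 15, 5, 23, 17, 16, 25, 6, 11, 21, 26, 2, 22, 1, 10, 8, 14, 27 - $w_{20}$: 14, 11, 10, 28, 25, 18, 26, 15, 13, 21, 1, 30, 17, 6, 2, 23, 12, 5, 16, 20, 4, 19, 22, 8, 7, 29, 24, 9, 3, 27 - $w_{21}$: 25, 18, 19, 9, 30, 28, 27, 17, 26, 7, 11, 13, 24, 29, 22, 21, 6, 12, 1, 5, 2, 23, 15, 4, 20, 10, 16, 3, 14, 8 - $w_{22}$: 7, 13, 24, 19, 9, 3, 15, 17, 10, 2, 12, 8, 14, 22, 18, 27, 23, 21, 29, 25, 28, 4, 26, 16, 6, 11, 1, 30, 5, 20 - $w_{23}$: 7, 1, 27, 14, 29, 4, 13, 10, 11, 12, 9, 8, 21, 24, 23, 5, 19, 17, 22, 26, 28, 16, 25, 3, 15, 18, 20, 30, 2, 6 - $w_{24}$: 4, 25, 21, 10, 29, 16, 30, 14, 19, 20, 24, 27, 9, 6, 12, 5, 1, 8,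 7, 3, 13, 18, 26, 28, 23, 2, 11, 17, 22, 15 - $w_{25}$: 7, 1, 18, 10, 2, 14, 21, 17, 3, 29, 27, 4, 6, 12, 20, 8, 22, 15, 16, 25, 11, 23, 9, 30, 26, 19, 5, 13, 24, 28 - $w_{26}$: 26, 7, 18, 1, 21, 14, 10, 12, 17, 25, 29, 3, 22, 8, 16, 13, 15, 20, 4, 23, 27, 2, 19, 28, 11, 30, 24, 6, 5, 9 - $w_{27}$: 6, 5, 30, 18, 14, 27, 7, 29, 13, 4, 26, 23, 3, 21, 8, 11, 25, 16, 22, 20, 10, 28, 2, 9, 15, 12, 1, 17, 24, 19 - $w_{28}$: 4, 3, 7, 6, 15, 24, 27, 19, 20, 9, 1, 30, 23, 2, 5, 13, 21, 18, 28, 29, 25, 22, 17, 10, 26, 14, 16, 12, 8, 11 - $w_{29}$: 16, 18, 28, 26, 12, 10, 21, 20, 3, 22, 5, 6, 13, 9, 25, 24, 23, 4, 19, 8, 14, 2, 11, 17, 7, 30, 27, 1, 29, 15 - $w_{30}$: 15, 10, 14, 4, 11, 5, 3, 13, 24, 9, 2, 27, 6, 8, 12, 28, 18, 1, 7, 26,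 25, 17, 29, 21, 30, 20, 22, 16, 19, 23 -/

import Mathlib

namespace MatchingGame

/-! ### Preference lists, profiles and instances

Both sides of the market are indexed by `Fin n`. -/

/-- A strict total order over `n` agents, written as a list of all of them,
most preferred first. -/
@[ext]
structure PrefList (n : ℕ) where
  /-- the agents, most preferred first -/
  list : List (Fin n)
  nodup : list.Nodup
  complete : ∀ x, x ∈ list

namespace PrefList

variable {n : ℕ}

/-- `x` is strictly preferred to `y`. -/
def Prefers (p : PrefList n) (x y : Fin n) : Prop :=
  p.list.idxOf x < p.list.idxOf y

instance (p : PrefList n) (x y : Fin n) : Decidable (p.Prefers x y) :=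
  inferInstanceAs (Decidable (_ < _))

/-- `x` is weakly preferred to `y`. -/
def WeakPrefers (p : PrefList n) (x y : Fin n) : Prop :=
  p.Prefers x y ∨ x = y

/-- The agents ranked above `y`. -/
def above (p : PrefList n) (y : Fin n) : Finset (Fin n) :=
  Finset.univ.filter fun x => p.Prefers x y

/-- The agents ranked below `y`. -/
def below (p : PrefList n) (y : Fin n) : Finset (Fin n) :=
  Finset.univ.filter fun x => p.Prefers y x

end PrefList

/-- A preference list for each agent of one side. -/
abbrev Profile (n : ℕ) := Fin n → PrefList n

/-- A stable matching instance: the true preferences of `n` men and `n` women. -/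
structure Market (n : ℕ) where
  men : Profile n
  women : Profile n

/-- A matching, sending each man to his partner; `μ.symm` sends each woman to hers. -/
abbrev Matching (n : ℕ) := Fin n ≃ Fin n

/-- `μ` has no blocking pair under the men's profile `pm` and the women's profile `pw`. -/
def IsStable {n : ℕ} (pm pw : Profile n) (μ : Matching n) : Prop :=
  ¬ ∃ m w, (pm m).Prefers w (μ m) ∧ (pw w).Prefers m (μ.symm w)

/-! ### Men-proposing deferred acceptance -/

section DeferredAcceptance

variable {n : ℕ} (pm pw : Profile n)

/-- If `R` is the set of pairs `(m, w)` such that `w` has already rejected `m`, this is the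
woman to whom `m` is proposing: his favourite among those who have not rejected him. -/
def proposal (R : Finset (Fin n × Fin n)) (m : Fin n) : Option (Fin n) :=
  (pm m).list.find? fun w => decide ((m, w) ∉ R)

/-- One round: every woman keeps her favourite among the men now proposing to her and rejects
all the others. -/
def round (R : Finset (Fin n × Fin n)) : Finset (Fin n × Fin n) :=
  R ∪ Finset.univ.filter fun x => proposal pm R x.1 = some x.2 ∧
    ∃ m', proposal pm R m' = some x.2 ∧ (pw x.2).Prefers m' x.1

/-- The rejections at termination. Every round before termination adds a rejection, so that
`n * n` rounds suffice (see `round_rejections`). -/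
def rejections : Finset (Fin n × Fin n) :=
  (round pm pw)^[n * n] ∅

theorem proposal_eq_some_iff {pm : Profile n} {R : Finset (Fin n × Fin n)} {m w : Fin n} :
    proposal pm R m = some w ↔
      (m, w) ∉ R ∧ ∀ v, (pm m).Prefers v w → (m, v) ∈ R := by
  unfold proposal
  rw [List.find?_eq_some_iff_append]
  simp only [decide_eq_true_eq, Bool.not_eq_true', decide_eq_false_iff_not, not_not]
  refine and_congr_right fun _ => ?_
  have hnd := (pm m).nodup
  constructor
  · rintro ⟨as, bs, hl, has⟩ v hv
    apply has
    have hw : w ∉ as := by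
      rw [hl, List.nodup_append] at hnd
      exact fun hw => hnd.2.2 w hw w List.mem_cons_self rfl
    by_contra hva
    unfold PrefList.Prefers at hv
    rw [hl, List.idxOf_append_of_notMem hw, List.idxOf_append_of_notMem hva] at hv
    simp at hv
  · intro h
    obtain ⟨as, bs, hl⟩ := List.append_of_mem ((pm m).complete w)
    refine ⟨as, bs, hl, fun v hv => h v ?_⟩
    have hw : w ∉ as := by
      rw [hl, List.nodup_append] at hnd
      exact fun hw => hnd.2.2 w hw w List.mem_cons_self rfl
    unfold PrefList.Prefers
    rw [hl, List.idxOf_append_of_notMem hw, List.idxOf_append_of_mem hv]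
    have := List.idxOf_lt_length_of_mem hv
    omega

theorem subset_round (R : Finset (Fin n × Fin n)) : R ⊆ round pm pw R :=
  Finset.subset_union_left

/-- No further rejection happens, so that the procedure has terminated. -/
theorem round_rejections : round pm pw (rejections pm pw) = rejections pm pw := by
  by_contra hne
  have key : ∀ k ≤ n * n + 1, k ≤ ((round pm pw)^[k] ∅).card := by
    intro k
    induction k with
    | zero => simp
    | succ k ih =>
      intro hk
      rw [Function.iterate_succ_apply']
      have hlt : (round pm pw)^[k] ∅ ⊂ round pm pw ((round pm pw)^[k] ∅) := by
        refine (subset_round pm pw _).ssubset_of_ne fun heq => hne ?_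
        have hfix : Function.IsFixedPt (round pm pw) ((round pm pw)^[k] ∅) := heq.symm
        have : rejections pm pw = (round pm pw)^[k] ∅ := by
          unfold rejections
          rw [show n * n = (n * n - k) + k by omega, Function.iterate_add_apply,
            hfix.iterate]
        rw [this]
        exact hfix
      have := Finset.card_lt_card hlt
      have := ih (by omega)
      omega
  have h1 := key _ le_rfl
  have h2 := Finset.card_le_univ ((round pm pw)^[n * n + 1] ∅)
  simp only [Fintype.card_prod, Fintype.card_fin] at h2
  omega

theorem exists_proposal_of_mem (k : ℕ) (m w : Fin n) (h : (m, w) ∈ (round pm pw)^[k] ∅) :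
    ∃ m', proposal pm ((round pm pw)^[k] ∅) m' = some w := by
  induction k generalizing m with
  | zero => simp at h
  | succ k ih =>
    rw [Function.iterate_succ_apply'] at h ⊢
    generalize (round pm pw)^[k] ∅ = R at ih h ⊢
    have hne : ∃ m', proposal pm R m' = some w := by
      rcases Finset.mem_union.mp h with h | h
      · exact ih m h
      · exact ⟨m, (Finset.mem_filter.mp h).2.1⟩
    obtain ⟨m', hm', hmin⟩ := Finset.exists_min_image
      (Finset.univ.filter fun m' => proposal pm R m' = some w)
      (fun m' => (pw w).list.idxOf m')
      (hne.imp fun m' h => Finset.mem_filter.mpr ⟨Finset.mem_univ _, h⟩)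
    have hm' := (Finset.mem_filter.mp hm').2
    refine ⟨m', proposal_eq_some_iff.mpr ⟨fun hmem => ?_, fun v hv =>
      subset_round pm pw R ((proposal_eq_some_iff.mp hm').2 v hv)⟩⟩
    rcases Finset.mem_union.mp hmem with hmem | hmem
    · exact (proposal_eq_some_iff.mp hm').1 hmem
    · obtain ⟨m'', h1, h2⟩ := (Finset.mem_filter.mp hmem).2.2
      exact absurd h2 (not_lt.mpr
        (hmin m'' (Finset.mem_filter.mpr ⟨Finset.mem_univ _, h1⟩)))

theorem proposal_injective {m m' w : Fin n}
    (h : proposal pm (rejections pm pw) m = some w)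
    (h' : proposal pm (rejections pm pw) m' = some w) : m = m' := by
  have key : ∀ a b : Fin n, proposal pm (rejections pm pw) a = some w →
      proposal pm (rejections pm pw) b = some w → ¬ (pw w).Prefers a b := by
    intro a b ha hb hab
    apply (proposal_eq_some_iff.mp hb).1
    rw [← round_rejections]
    exact Finset.mem_union_right _
      (Finset.mem_filter.mpr ⟨Finset.mem_univ _, hb, a, ha, hab⟩)
  have h1 := not_lt.mp (key m m' h h')
  have h2 := not_lt.mp (key m' m h' h)
  exact (List.idxOf_inj ((pw w).complete m)).mp (le_antisymm h2 h1)

theorem proposal_isSome (m : Fin n) : (proposal pm (rejections pm pw) m).isSome := by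
  by_contra hm
  rw [Option.not_isSome_iff_eq_none] at hm
  have hrej : ∀ w, (m, w) ∈ rejections pm pw := by
    intro w
    simpa using List.find?_eq_none.mp hm w ((pm m).complete w)
  choose g hg using fun w => exists_proposal_of_mem pm pw (n * n) m w (hrej w)
  have hinj : Function.Injective g := fun w w' h =>
    Option.some_injective _ ((hg w).symm.trans ((congrArg _ h).trans (hg w')))
  obtain ⟨w, hw⟩ := Finite.surjective_of_injective hinj m
  have := hg w
  rw [hw] at this
  exact absurd (this.symm.trans hm) (Option.some_ne_none w)

/-- The outcome of deferred acceptance: each man is matched to the woman holding his proposal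
at termination. -/
noncomputable def DA : Matching n :=
  Equiv.ofBijective
    (fun m => (proposal pm (rejections pm pw) m).get (proposal_isSome pm pw m))
    (Finite.injective_iff_bijective.mp fun _ _ h =>
      proposal_injective pm pw (Option.some_get _).symm
        ((Option.some_get _).symm.trans (congrArg some h.symm)))

end DeferredAcceptance

/-! ### The accomplice manipulation game and push-up dynamics -/

section Game

variable {n : ℕ} (I : Market n)

/-- At the strategy profile `p`, the misreport `q` of man `m` is an accomplice manipulation by
`(m, w)`: with respect to true preferences, `w` is strictly better off and `m` is not worse
off. Women report truthfully. -/
def IsManipulation (p : Profile n) (m w : Fin n) (q : PrefList n) : Prop :=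
  (I.women w).Prefers ((DA (Function.update p m q) I.women).symm w) ((DA p I.women).symm w) ∧
  (I.men m).WeakPrefers (DA (Function.update p m q) I.women m) (DA p I.women m)

/-- `p` is a Nash equilibrium of the game with strategic pairs `P`. -/
def IsNash (P : Set (Fin n × Fin n)) (p : Profile n) : Prop :=
  ¬ ∃ m w q, (m, w) ∈ P ∧ IsManipulation I p m w q

/-- The list `q` results from a push-up operation of `m` at `p`: for some set `X` of women, the
women above his current partner are those who were above her before together with `X`, and
those below her are those who were below her and are not in `X`. The order within the two
parts is arbitrary. -/
def IsPushUp (p : Profile n) (m : Fin n) (q : PrefList n) : Prop :=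
  ∃ X : Finset (Fin n),
    q.above (DA p I.women m) = (p m).above (DA p I.women m) ∪ X ∧
    q.below (DA p I.women m) = (p m).below (DA p I.women m) \ X

/-- `p'` results from a push-up accomplice manipulation at `p` by some pair in `P`. -/
def PushUpStep (P : Set (Fin n × Fin n)) (p p' : Profile n) : Prop :=
  ∃ m w q, (m, w) ∈ P ∧ IsPushUp I p m q ∧ IsManipulation I p m w q ∧
    p' = Function.update p m q

/-- A realization of the push-up dynamics: it starts at the truthful profile and makes a
push-up manipulation whenever one is possible. -/
def IsPushUpDynamic (P : Set (Fin n × Fin n)) (s : ℕ → Profile n) : Prop :=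
  s 0 = I.men ∧
  ∀ t, PushUpStep I P (s t) (s (t + 1)) ∨
    ((¬ ∃ p', PushUpStep I P (s t) p') ∧ s (t + 1) = s t)

/-- The dynamic `s` reaches `p`, at which no push-up manipulation is possible. -/
def ConvergesTo (P : Set (Fin n × Fin n)) (s : ℕ → Profile n) (p : Profile n) : Prop :=
  ∃ t, s t = p ∧ ¬ ∃ p', PushUpStep I P p p'

end Game

/-! ### The instance with 30 men and 30 women -/

/-- The true preference lists of men `1, …, 30` (agents are numbered from 1,
most preferred first). -/
def menTable : List (List ℕ) :=
  [[22, 18, 15, 28, 25, 3, 19, 1, 23, 20, 16, 8, 27, 2, 24, 30, 21, 9, 10, 13, 11, 14, 26, 17, 29, 12, 6, 7, 5, 4],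
   [25, 1, 4, 23, 3, 15, 22, 12, 26, 8, 7, 17, 9, 11, 16, 28, 19, 10, 2, 14, 5, 18, 21, 29, 30, 27, 24, 6, 20, 13],
   [18, 16, 12, 13, 22, 27, 15, 30, 4, 2, 11, 23, 1, 28, 3, 24, 5, 26, 19, 29, 17, 8, 20, 10, 21, 6, 25, 9, 7, 14],
   [11, 30, 19, 23, 16, 14, 17, 21, 26, 10, 28, 27, 15, 13, 8, 5, 29, 4, 22, 6, 20, 7, 1, 25, 3, 18, 12, 24, 9, 2],
   [30, 16, 19, 7, 2, 27, 24, 13, 8, 6, 17, 20, 12, 9, 5, 23, 3, 1, 22, 25, 26, 4, 15, 11, 10, 18, 21, 29, 14, 28],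
   [18, 17, 24, 7, 25, 29, 27, 28, 14, 10, 5, 19, 9, 4, 6, 20, 23, 3, 13, 16, 2, 12, 1, 26, 30, 15, 11, 22, 8, 21],
   [28, 6, 7, 18, 3, 10, 17, 21, 19, 22, 5, 12, 30, 9, 14, 13, 20, 1, 23, 24, 27, 11, 29, 26, 25, 4, 15, 2, 8, 16],
   [15, 7, 14, 5, 28, 27, 20, 2, 22, 1, 6, 18, 24, 29, 21, 3, 9, 17, 23, 19, 4, 10, 30, 25, 26, 13, 8, 12, 11, 16],
   [14, 4, 19, 17, 29, 24, 30, 8, 12, 27, 2, 6, 9, 1, 20, 15, 3, 16, 18, 11, 13, 22, 21, 25, 23, 5, 26, 7, 28, 10],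
   [7, 28, 2, 19, 22, 4, 29, 24, 15, 17, 25, 23, 5, 6, 1, 21, 13, 11, 10, 8, 30, 9, 16, 20, 12, 3, 18, 14, 26, 27],
   [8, 22, 28, 10, 1, 9, 16, 4, 14, 6, 17, 19, 24, 25, 5, 18, 13, 11, 21, 3, 30, 27, 26, 2, 23, 29, 15, 20, 7, 12],
   [7, 29, 26, 9, 5, 2, 1, 15, 12, 8, 3, 25, 16, 24, 17, 28, 14, 19, 23, 10, 4, 13, 11, 6, 18, 30, 27, 22, 21, 20],
   [21, 13, 15, 8, 2, 24, 6, 12, 30, 4, 23, 7, 17, 10, 27, 20, 26, 14, 29, 19, 9, 11, 25, 18, 1, 22, 16, 5, 3, 28],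
   [20, 17, 23, 30, 27, 10, 3, 16, 24, 5, 25, 13, 12, 4, 1, 28, 29, 21, 22, 2, 7, 14, 8, 6, 11, 18, 19, 15, 9, 26],
   [15, 25, 9, 12, 26, 20, 8, 23, 28, 11, 14, 18, 22, 5, 17, 30, 27, 3, 29, 7, 1, 13, 10, 21, 2, 24, 16, 6, 19, 4],
   [16, 19, 12, 24, 5, 1, 3, 10, 22, 2, 26, 23, 14, 25, 11, 9, 15, 28, 4, 30, 7, 6, 29, 27, 8, 13, 17, 21, 18, 20],
   [15, 9, 1, 29, 24, 12, 8, 7, 25, 4, 23, 6, 5, 22, 13, 17, 26, 21, 30, 11, 16, 28, 18, 19, 10, 2, 3, 14, 27, 20],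
   [21, 17, 9, 20, 1, 15, 6, 23, 11, 22, 29, 3, 12, 8, 24, 5, 7, 4, 2, 26, 16, 19, 18, 27, 28, 14, 13, 30, 25, 10],
   [24, 30, 16, 29, 15, 22, 23, 7, 28, 26, 14, 19, 1, 9, 11, 18, 27, 10, 17, 25, 6, 12, 2, 8, 3, 4, 20, 5, 13, 21],
   [25, 29, 1, 23, 12, 27, 7, 2, 19, 30, 18, 22, 5, 13, 3, 26, 16, 4, 28, 20, 9, 17, 15, 21, 10, 11, 8, 6, 14, 24],
   [21, 2, 25, 24, 26, 14, 22, 28, 20, 18, 9, 12, 8, 5, 17, 16, 23, 11, 30, 4, 15, 13, 19, 10, 7, 3, 29, 6, 1, 27],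
   [17, 7, 10, 29, 4, 26, 9, 5, 14, 22, 1, 18, 3, 25, 20, 28, 2, 30, 11, 13, 6, 19, 23, 12, 8, 15, 24, 21, 16, 27],
   [27, 28, 29, 25, 20, 8, 7, 24, 30, 12, 17, 11, 13, 5, 22, 2, 3, 23, 26, 19, 4, 18, 10, 16, 1, 15, 21, 9, 14, 6],
   [21, 29, 6, 25, 4, 12, 23, 20, 7, 22, 11, 19, 5, 2, 24, 9, 18, 26, 16, 3, 28, 8, 27, 17, 10, 30, 1, 14, 15, 13],
   [2, 30, 22, 3, 13, 1, 11, 19, 21, 17, 29, 8, 23, 26, 14, 10, 28, 6, 4, 15, 7, 16, 25, 12, 9, 24, 18, 5, 20, 27],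
   [20, 21, 7, 15, 2, 19, 25, 16, 29, 17, 13, 23, 10, 22, 30, 12, 18, 14, 27, 26, 3, 4, 6, 28, 11, 5, 8, 24, 9, 1],
   [6, 7, 22, 13, 5, 18, 16, 17, 4, 3, 11, 12, 9, 27, 24, 30, 25, 1, 15, 10, 26, 28, 23, 20, 29, 14, 19, 2, 8, 21],
   [6, 13, 28, 8, 26, 10, 9, 25, 23, 15, 2, 29, 16, 3, 17, 5, 24, 7, 1, 11, 14, 20, 27, 19, 21, 18, 22, 4, 12, 30],
   [29, 17, 11, 30, 10, 13, 24, 21, 19, 25, 23, 1, 12, 27, 6, 3, 9, 4, 8, 14, 26, 18, 22, 2, 20, 28, 5, 15, 7, 16],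
   [2, 18, 16, 28, 5, 24, 9, 15, 30, 13, 29, 17, 22, 11, 7, 10, 8, 19, 23, 27, 21, 20, 14, 3, 25, 1, 26, 6, 4, 12]]

/-- The true preference lists of women `1, …, 30`. -/
def womenTable : List (List ℕ) :=
  [[21, 5, 14, 23, 4, 1, 27, 24, 13, 17, 11, 22, 2, 10, 19, 8, 3, 15, 16, 18, 6, 26, 20, 12, 29, 7, 9, 28, 25, 30],
   [14, 11, 23, 26, 4, 21, 10, 28, 16, 3, 25, 5, 17, 20, 1, 27, 24, 9, 29, 12, 6, 30, 7, 13, 22, 15, 19, 8, 18, 2],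
   [4, 29, 27, 23, 28, 17, 8, 26, 5, 25, 6, 16, 14, 15, 1, 24, 10, 7, 13, 11, 3, 18, 22, 30, 9, 12, 2, 21, 19, 20],
   [10, 13, 12, 19, 4, 11, 24, 28, 6, 23, 3, 25, 14, 17, 20, 5, 27, 15, 26, 8, 16, 18, 2, 1, 21, 7, 29, 30, 9, 22],
   [17, 29, 20, 9, 10, 13, 26, 23, 22, 28, 4, 5, 21, 30, 3, 19, 27, 12, 24, 2, 7, 18, 16, 25, 1, 8, 14, 6, 11, 15],
   [10, 22, 5, 1, 7, 20, 2, 30, 4, 14, 8, 26, 16, 12, 3, 6, 9, 18, 21, 13, 29, 28, 23, 19, 11, 24, 27, 15, 25, 17],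
   [26, 13, 16, 8, 24, 25, 20, 4, 7, 5, 2, 14, 9, 29, 27, 18, 15, 19, 11, 1, 22, 30, 17, 12, 23, 3, 10, 6, 21, 28],
   [1, 28, 15, 11, 10, 25, 8, 30, 21, 26, 16, 19, 27, 17, 23, 12, 24, 5, 20, 2, 18, 7, 6, 14, 13, 3, 22, 9, 4, 29],
   [2, 27, 4, 11, 20, 6, 22, 7, 16, 5, 17, 24, 14, 26, 15, 10, 30, 13, 19, 23, 3, 21, 1, 25, 18, 28, 8, 9, 29, 12],
   [30, 4, 7, 28, 3, 10, 13, 27, 20, 16, 14, 26, 5, 2, 11, 9, 24, 23, 6, 17, 19, 1, 15, 22, 25, 8, 29, 12, 18, 21],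
   [29, 7, 28, 23, 26, 10, 20, 21, 24, 6, 1, 18, 15, 19, 5, 11, 13, 16, 4, 17, 3, 8, 12, 14, 25, 9, 27, 22, 30, 2],
   [4, 28, 9, 27, 8, 30, 1, 25, 24, 6, 2, 16, 19, 29, 15, 13, 5, 12, 21, 3, 17, 7, 26, 11, 10, 18, 20, 23, 22, 14],
   [18, 28, 5, 7, 23, 2, 24, 22, 16, 13, 10, 9, 21, 1, 14, 29, 3, 19, 6, 25, 4, 27, 17, 20, 30, 12, 8, 26, 15, 11],
   [11, 14, 7, 16, 26, 19, 5, 21, 10, 12, 15, 4, 1, 22, 28, 30, 13, 17, 8, 6, 27, 2, 24, 20, 25, 3, 18, 9, 29, 23],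
   [23, 9, 8, 21, 22, 29, 24, 15, 14, 27, 4, 13, 10, 25, 11, 7, 28, 26, 1, 5, 16, 12, 2, 20, 6, 3, 18, 30, 17, 19],
   [16, 29, 6, 5, 26, 2, 7, 3, 24, 22, 19, 8, 13, 18, 12, 15, 17, 9, 10, 25, 20, 11, 30, 28, 27, 4, 21, 1, 23, 14],
   [21, 23, 2, 13, 28, 22, 27, 10, 7, 29, 8, 9, 25, 11, 24, 6, 15, 30, 17, 19, 26, 20, 18, 16, 3, 12, 4, 14, 1, 5],
   [18, 24, 30, 10, 1, 14, 26, 16, 4, 7, 29, 25, 8, 5, 19, 13, 9, 3, 23, 2, 21, 27, 17, 20, 12, 15, 6, 11, 28, 22],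
   [4, 19, 12, 29, 28, 30, 9, 3, 24, 7, 13, 18, 20, 15, 5, 23, 17, 16, 25, 6, 11, 21, 26, 2, 22, 1, 10, 8, 14, 27],
   [14, 11, 10, 28, 25, 18, 26, 15, 13, 21, 1, 30, 17, 6, 2, 23, 12, 5, 16, 20, 4, 19, 22, 8, 7, 29, 24, 9, 3, 27],
   [25, 18, 19, 9, 30, 28, 27, 17, 26, 7, 11, 13, 24, 29, 22, 21, 6, 12, 1, 5, 2, 23, 15, 4, 20, 10, 16, 3, 14, 8],
   [7, 13, 24, 19, 9, 3, 15, 17, 10, 2, 12, 8, 14, 22, 18, 27, 23, 21, 29, 25, 28, 4, 26, 16, 6, 11, 1, 30, 5, 20],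
   [7, 1, 27, 14, 29, 4, 13, 10, 11, 12, 9, 8, 21, 24, 23, 5, 19, 17, 22, 26, 28, 16, 25, 3, 15, 18, 20, 30, 2, 6],
   [4, 25, 21, 10, 29, 16, 30, 14, 19, 20, 24, 27, 9, 6, 12, 5, 1, 8, 7, 3, 13, 18, 26, 28, 23, 2, 11, 17, 22, 15],
   [7, 1, 18, 10, 2, 14, 21, 17, 3, 29, 27, 4, 6, 12, 20, 8, 22, 15, 16, 25, 11, 23, 9, 30, 26, 19, 5, 13, 24, 28],
   [26, 7, 18, 1, 21, 14, 10, 12, 17, 25, 29, 3, 22, 8, 16, 13, 15, 20, 4, 23, 27, 2, 19, 28, 11, 30, 24, 6, 5, 9],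
   [6, 5, 30, 18, 14, 27, 7, 29, 13, 4, 26, 23, 3, 21, 8, 11, 25, 16, 22, 20, 10, 28, 2, 9, 15, 12, 1, 17, 24, 19],
   [4, 3, 7, 6, 15, 24, 27, 19, 20, 9, 1, 30, 23, 2, 5, 13, 21, 18, 28, 29, 25, 22, 17, 10, 26, 14, 16, 12, 8, 11],
   [16, 18, 28, 26, 12, 10, 21, 20, 3, 22, 5, 6, 13, 9, 25, 24, 23, 4, 19, 8, 14, 2, 11, 17, 7, 30, 27, 1, 29, 15],
   [15, 10, 14, 4, 11, 5, 3, 13, 24, 9, 2, 27, 6, 8, 12, 28, 18, 1, 7, 26, 25, 17, 29, 21, 30, 20, 22, 16, 19, 23]]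

/-- Row `i` of a table, with agent `k` of the table becoming `k - 1 : Fin 30`. -/
def row (T : List (List ℕ)) (i : Fin 30) : List (Fin 30) :=
  (T.getD i []).map fun k => Fin.ofNat 30 (k - 1)

/-- The computer-generated instance. -/
def market30 : Market 30 where
  men i := ⟨row menTable i, by revert i; decide +kernel, by revert i; decide +kernel⟩
  women i := ⟨row womenTable i, by revert i; decide +kernel, by revert i; decide +kernel⟩

end MatchingGame

namespace MatchingGame

/-! ### Deferred acceptance: optimality and strategyproofness -/

section Theory

variable {n : ℕ}

/-! Two short sequences of push-ups are exhibited. In each step one man moves a single woman to the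
top of his list. She rejects him in the end and he keeps his partner, but his extra proposal sets
off a chain of rejections from which some woman gains. Two steps lead to `profileA`, three to
`profileB`; the resulting matchings differ in the partners of five men, all of whom are truly better
off in the second.

Only the equilibrium property is not plainly a finite check, since a deviation may be any of 30!
lists. It is reduced to finitely many runs by `isNash_of_attainable`. Let `μ` be the outcome at `p`.
By strategyproofness at `p`, a man `m` who does not lose by deviating keeps his partner `μ m`. If a
woman `u` prefers `m` to her partner in `μ`, suppose that some matching gives `u` to `m` and is
blocked by no other man. By strategyproofness at the new profile, `m` cannot have ranked `u` above
`μ m` there. Hence `μ` is still stable, men weakly prefer the new outcome to it, and a woman who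
gained would block `μ` at `p` together with her new partner. Strategyproofness comes from the
blocking lemma. At an equilibrium no push-up manipulation exists either, so both dynamics stop.

An outcome of deferred acceptance is certified by `DA_eq_of_rejections`: the claimed matching is
stable, and a sequential run, sound by `mem_rejections_of_daRun`, shows that every man is rejected
by all women he ranks above his claimed partner. Tables are single natural numbers, so that the
kernel can carry out these checks. -/

theorem PrefList.prefers_or_prefers (p : PrefList n) {x y : Fin n} (h : x ≠ y) :
    p.Prefers x y ∨ p.Prefers y x := by
  rcases lt_trichotomy (p.list.idxOf x) (p.list.idxOf y) with h' | h' | h'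
  · exact .inl h'
  · exact absurd ((List.idxOf_inj (p.complete x)).mp h') h
  · exact .inr h'

theorem proposal_DA (pm pw : Profile n) (m : Fin n) :
    proposal pm (rejections pm pw) m = some (DA pm pw m) :=
  (Option.some_get _).symm

theorem eq_DA_of_proposal {pm pw : Profile n} {m w : Fin n}
    (h : proposal pm (rejections pm pw) m = some w) : DA pm pw m = w :=
  Option.some_injective _ ((proposal_DA pm pw m).symm.trans h)

theorem DA_notMem (pm pw : Profile n) (m : Fin n) : (m, DA pm pw m) ∉ rejections pm pw :=
  (proposal_eq_some_iff.mp (proposal_DA pm pw m)).1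

theorem iterate_round_mono (pm pw : Profile n) {i j : ℕ} (h : i ≤ j) :
    (round pm pw)^[i] ∅ ⊆ (round pm pw)^[j] ∅ := by
  induction h with
  | refl => exact subset_rfl
  | step _ ih =>
    rw [Function.iterate_succ_apply']
    exact ih.trans (subset_round pm pw _)

/-- The best proposer to a woman is not rejected in the next round. -/
theorem exists_proposal_round {pm pw : Profile n} {R : Finset (Fin n × Fin n)} {w m : Fin n}
    (h : proposal pm R m = some w) :
    ∃ m', proposal pm R m' = some w ∧ proposal pm (round pm pw R) m' = some w ∧
      (pw w).list.idxOf m' ≤ (pw w).list.idxOf m := by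
  obtain ⟨m', hm', hmin⟩ := Finset.exists_min_image
    (Finset.univ.filter fun m' => proposal pm R m' = some w)
    (fun m' => (pw w).list.idxOf m') ⟨m, Finset.mem_filter.mpr ⟨Finset.mem_univ _, h⟩⟩
  have hm' := (Finset.mem_filter.mp hm').2
  refine ⟨m', hm', proposal_eq_some_iff.mpr ⟨fun hmem => ?_, fun v hv =>
    subset_round pm pw R ((proposal_eq_some_iff.mp hm').2 v hv)⟩,
    hmin m (Finset.mem_filter.mpr ⟨Finset.mem_univ _, h⟩)⟩
  rcases Finset.mem_union.mp hmem with hmem | hmem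
  · exact (proposal_eq_some_iff.mp hm').1 hmem
  · obtain ⟨m'', h1, h2⟩ := (Finset.mem_filter.mp hmem).2.2
    exact absurd h2 (not_lt.mpr
      (hmin m'' (Finset.mem_filter.mpr ⟨Finset.mem_univ _, h1⟩)))

/-- The best proposal a woman holds survives each round, so what she holds never gets worse after
she has rejected someone. -/
theorem exists_better_proposal (pm pw : Profile n) (k : ℕ) {m w : Fin n}
    (h : (m, w) ∈ (round pm pw)^[k] ∅) :
    ∃ m', proposal pm ((round pm pw)^[k] ∅) m' = some w ∧ (pw w).Prefers m' m := by
  induction k generalizing m with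
  | zero => simp at h
  | succ k ih =>
    rw [Function.iterate_succ_apply'] at h ⊢
    have hne : ∃ m', proposal pm ((round pm pw)^[k] ∅) m' = some w ∧ (pw w).Prefers m' m := by
      rcases Finset.mem_union.mp h with h | h
      · exact ih h
      · exact (Finset.mem_filter.mp h).2.2
    obtain ⟨m0, h0, h0'⟩ := hne
    obtain ⟨m', -, h1, h2⟩ := exists_proposal_round (pw := pw) h0
    exact ⟨m', h1, lt_of_le_of_lt h2 h0'⟩

/-- A woman prefers her final partner to every man she has rejected. -/
theorem prefers_of_mem_rejections {pm pw : Profile n} {m w : Fin n}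
    (h : (m, w) ∈ rejections pm pw) : (pw w).Prefers ((DA pm pw).symm w) m := by
  obtain ⟨m', h1, h2⟩ := exists_better_proposal pm pw _ h
  rwa [← eq_DA_of_proposal h1, Equiv.symm_apply_apply, eq_DA_of_proposal h1]

theorem mem_of_mem_round (pm pw : Profile n) (k : ℕ) {m w v : Fin n}
    (h : (m, w) ∈ (round pm pw)^[k] ∅) (hv : (pm m).Prefers v w) :
    (m, v) ∈ (round pm pw)^[k] ∅ := by
  induction k with
  | zero => simp at h
  | succ k ih =>
    rw [Function.iterate_succ_apply'] at h ⊢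
    rcases Finset.mem_union.mp h with h | h
    · exact subset_round pm pw _ (ih h)
    · exact subset_round pm pw _
        ((proposal_eq_some_iff.mp (Finset.mem_filter.mp h).2.1).2 v hv)

/-- A man has been rejected by exactly the women he prefers to his final partner. -/
theorem mem_rejections_iff {pm pw : Profile n} {m w : Fin n} :
    (m, w) ∈ rejections pm pw ↔ (pm m).Prefers w (DA pm pw m) := by
  refine ⟨fun h => ?_, (proposal_eq_some_iff.mp (proposal_DA pm pw m)).2 w⟩
  have hne : w ≠ DA pm pw m := fun he => DA_notMem pm pw m (he ▸ h)
  exact ((pm m).prefers_or_prefers hne).resolve_right fun h' =>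
    DA_notMem pm pw m (mem_of_mem_round pm pw _ h h')

/-- Otherwise `a` ends up with `w`, while `b` either ends up with her too or was rejected by her in
favour of a better man. The rule does not mention rounds, so it justifies rejections found by
proposals made in any order. -/
theorem mem_rejections_of_prefers {pm pw : Profile n} {a b w : Fin n}
    (ha : ∀ v, (pm a).Prefers v w → (a, v) ∈ rejections pm pw)
    (hb : ∀ v, (pm b).Prefers v w → (b, v) ∈ rejections pm pw)
    (hab : (pw w).Prefers b a) : (a, w) ∈ rejections pm pw := by
  by_contra h
  have ha' : DA pm pw a = w := eq_DA_of_proposal (proposal_eq_some_iff.mpr ⟨h, ha⟩)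
  by_cases hbw : (b, w) ∈ rejections pm pw
  · have := prefers_of_mem_rejections hbw
    rw [← ha', Equiv.symm_apply_apply, ha'] at this
    exact lt_asymm this hab
  · have hb' := eq_DA_of_proposal (proposal_eq_some_iff.mpr ⟨hbw, hb⟩)
    rw [(DA pm pw).injective (ha'.trans hb'.symm)] at hab
    exact lt_irrefl _ hab

/-! ### The blocking lemma and its consequences. -/

/-- No pair with a man in `A` blocks `ν`. -/
def UnblockedOn (pm pw : Profile n) (A : Set (Fin n)) (ν : Matching n) : Prop :=
  ∀ a ∈ A, ∀ w, (pm a).Prefers w (ν a) → ¬ (pw w).Prefers a (ν.symm w)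

/-- The blocking lemma: if some men prefer `ν` to the outcome of deferred acceptance, then a man
who does not is in a blocking pair of `ν`. -/
theorem blocking_lemma {pm pw : Profile n} {ν : Matching n} {m : Fin n}
    (hm : (pm m).Prefers (ν m) (DA pm pw m)) :
    ¬ UnblockedOn pm pw {a | ¬ (pm a).Prefers (ν a) (DA pm pw a)} ν := by
  intro hν
  set μ := DA pm pw with hμ
  set R : ℕ → Finset (Fin n × Fin n) := fun k => (round pm pw)^[k] ∅ with hR
  have hsub : ∀ k ≤ n * n, R k ⊆ rejections pm pw := fun k hk => iterate_round_mono pm pw hk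
  -- A man who does not prefer `ν` and would be accepted by a woman who rejects him in `μ` blocks.
  have block : ∀ a w, ¬ (pm a).Prefers (ν a) (μ a) →
      (pm a).Prefers w (μ a) ∨ w = μ a → ν a ≠ w → ¬ (pw w).Prefers a (ν.symm w) := by
    intro a w ha hw hne
    refine hν a ha w ?_
    by_contra hlt
    have h1 := ((pm a).prefers_or_prefers hne).resolve_right hlt
    rcases hw with hw | rfl
    · exact ha (lt_trans h1 hw)
    · exact ha h1
  have himage : ∀ a, (pm a).Prefers (ν a) (μ a) →
      (pm (μ.symm (ν a))).Prefers (ν (μ.symm (ν a))) (μ (μ.symm (ν a))) := by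
    intro a ha
    by_contra hb
    have hr := prefers_of_mem_rejections (mem_rejections_iff.mpr ha)
    refine block _ (ν a) hb (.inr (μ.apply_symm_apply _).symm) (fun he => ?_)
      (by rwa [Equiv.symm_apply_apply])
    rw [ν.injective he] at hb
    exact hb ha
  -- Hence the partners in `μ` of the men preferring `ν` are their partners in `ν`.
  have himage' : ∀ a, (pm a).Prefers (ν a) (μ a) →
      (pm (ν.symm (μ a))).Prefers (ν (ν.symm (μ a))) (μ (ν.symm (μ a))) := by
    let f : {a // (pm a).Prefers (ν a) (μ a)} → {a // (pm a).Prefers (ν a) (μ a)} :=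
      fun a => ⟨μ.symm (ν a), himage a a.2⟩
    have hf : Function.Surjective f := Finite.surjective_of_injective fun a b h =>
      Subtype.ext (ν.injective (μ.symm.injective (congrArg Subtype.val h)))
    intro a ha
    obtain ⟨b, hb⟩ := hf ⟨a, ha⟩
    have hb' : μ.symm (ν b) = a := congrArg Subtype.val hb
    rw [← hb', Equiv.apply_symm_apply, Equiv.symm_apply_apply]
    exact b.2
  -- The least such `k` is the first round after which no man preferring `ν` is rejected any more;
  -- `a` below is one of those rejected last.
  have hex : ∃ k, ∀ a w, (pm a).Prefers (ν a) (μ a) → (a, w) ∈ rejections pm pw →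
      (a, w) ∈ R k := ⟨n * n, fun _ _ _ h => h⟩
  classical
  obtain ⟨hk, hkmin⟩ := And.intro (Nat.find_spec hex) fun j => Nat.find_min hex (m := j)
  have hle : Nat.find hex ≤ n * n := Nat.find_min' hex fun _ _ _ h => h
  generalize Nat.find hex = k at hk hkmin hle
  cases k with
  | zero => exact absurd (hk m _ hm (mem_rejections_iff.mpr hm)) (by simp [hR])
  | succ j =>
    have := hkmin j (Nat.lt_succ_self j)
    push Not at this
    obtain ⟨a, w₁, ha, haw, haj⟩ := this
    have hstep : R (j + 1) = round pm pw (R j) := Function.iterate_succ_apply' _ _ _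
    have haj' : proposal pm (R j) a = some w₁ := by
      have := hk a w₁ ha haw
      rw [hstep] at this
      exact (Finset.mem_filter.mp ((Finset.mem_union.mp this).resolve_left haj)).2.1
    set b := ν.symm (μ a) with hb
    have hbν : ν b = μ a := ν.apply_symm_apply _
    have hbM := himage' a ha
    have hbrej : (b, μ a) ∈ R (j + 1) := by
      refine hk b _ hbM (mem_rejections_iff.mpr ?_)
      rw [← hbν]
      exact hbM
    have hc : ∃ c, proposal pm (R j) c = some (μ a) ∧ (pw (μ a)).Prefers c b := by
      rw [hstep] at hbrej
      rcases Finset.mem_union.mp hbrej with h | h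
      · exact exists_better_proposal pm pw j h
      · exact (Finset.mem_filter.mp h).2.2
    obtain ⟨c₀, hc₀, hc₀b⟩ := hc
    obtain ⟨c, hcj, hcj', hcc⟩ := exists_proposal_round (pw := pw) hc₀
    rw [← hstep] at hcj'
    have hcb : (pw (μ a)).Prefers c b := lt_of_le_of_lt hcc hc₀b
    have hca : c ≠ a := by
      rintro rfl
      have : w₁ = μ c := Option.some_injective _ (haj'.symm.trans hcj)
      exact DA_notMem pm pw c (this ▸ haw)
    -- In the end `μ a` is matched to `a`, so she rejects `c` after round `j + 1`. This is too late
    -- for a man preferring `ν`, so `c` is not one, and `c` and `μ a` block `ν`.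
    have hcrej : (c, μ a) ∈ rejections pm pw := by
      by_contra h
      refine hca (μ.injective (eq_DA_of_proposal (proposal_eq_some_iff.mpr ⟨h, fun v hv => ?_⟩)))
      exact hsub _ hle ((proposal_eq_some_iff.mp hcj').2 v hv)
    have hcM : ¬ (pm c).Prefers (ν c) (μ c) := fun h =>
      (proposal_eq_some_iff.mp hcj').1 (hk c _ h hcrej)
    refine block c (μ a) hcM (.inl (mem_rejections_iff.mp hcrej)) (fun he => ?_) hcb
    have : c = b := ν.injective (he.trans hbν.symm)
    exact lt_irrefl _ (this ▸ hcb)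

/-- A man cannot gain by misreporting: every matching that is not blocked by the other men gives
him at most what deferred acceptance does. -/
theorem not_prefers_DA {pm pw : Profile n} {ν : Matching n} {m : Fin n}
    (hν : UnblockedOn pm pw {m}ᶜ ν) : ¬ (pm m).Prefers (ν m) (DA pm pw m) := fun h =>
  blocking_lemma h fun a ha => hν a fun he => ha (by rwa [Set.mem_singleton_iff.mp he])

theorem isStable_iff {pm pw : Profile n} {ν : Matching n} :
    IsStable pm pw ν ↔ UnblockedOn pm pw Set.univ ν := by
  simp [IsStable, UnblockedOn]

theorem DA_isStable (pm pw : Profile n) : IsStable pm pw (DA pm pw) := by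
  rintro ⟨m, w, h1, h2⟩
  exact lt_asymm h2 (prefers_of_mem_rejections (mem_rejections_iff.mpr h1))

/-- The rejections bound each man's outcome from above by `ν`, and optimality of deferred acceptance
among stable matchings bounds it from below. -/
theorem DA_eq_of_rejections {pm pw : Profile n} {ν : Matching n} (hν : IsStable pm pw ν)
    (h : ∀ a w, (pm a).Prefers w (ν a) → (a, w) ∈ rejections pm pw) : DA pm pw = ν := by
  ext1 a
  by_contra hne
  rcases (pm a).prefers_or_prefers hne with h' | h'
  · exact DA_notMem pm pw a (h a _ h')
  · exact not_prefers_DA (fun b _ => isStable_iff.mp hν b trivial) h'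

/-- A criterion for Nash equilibria when the report of every man ranks above his partner all the
women whom he truly prefers to her: every woman `u` who would accept a man `m` is attainable for
him, so that he loses his partner if he ranks `u` above her. -/
theorem isNash_of_attainable {I : Market n} {p : Profile n} {μ : Matching n}
    (hμ : DA p I.women = μ) (P : Set (Fin n × Fin n))
    (htrue : ∀ m w, (I.men m).Prefers w (μ m) → (p m).Prefers w (μ m))
    (hatt : ∀ m u, (I.women u).Prefers m (μ.symm u) →
      ∃ ν : Matching n, ν m = u ∧ UnblockedOn p I.women {m}ᶜ ν) : IsNash I P p := by
  rintro ⟨m, w, q, -, hw, hm⟩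
  set p' := Function.update p m q with hp'
  set σ := DA p' I.women with hσ
  have hp'm : p' m = q := Function.update_self ..
  have hp'a : ∀ a ≠ m, p' a = p a := fun a ha => Function.update_of_ne ha ..
  have hunb : ∀ ν, UnblockedOn p I.women {m}ᶜ ν ↔ UnblockedOn p' I.women {m}ᶜ ν := by
    intro ν
    refine forall₂_congr fun a ha => ?_
    rw [hp'a a ha]
  have hstable := isStable_iff.mp (DA_isStable p I.women)
  have hstable' := isStable_iff.mp (DA_isStable p' I.women)
  rw [hμ] at hw hm hstable
  -- By `htrue`, a true gain for `m` would also be a gain with respect to his report `p m`, against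
  -- strategyproofness at `p`.
  have hσm : σ m = μ m := by
    refine hm.resolve_left fun h => ?_
    have := not_prefers_DA ((hunb σ).mpr fun a _ => hstable' a trivial)
    rw [hμ] at this
    exact this (htrue m _ h)
  -- Only `m` could block `μ` at `p'`. Had `q` ranked an attainable `u` above `μ m`,
  -- strategyproofness at `p'` would give him more than `σ m = μ m`.
  have hμ' : UnblockedOn p' I.women Set.univ μ := by
    intro a _ u hu hu'
    by_cases ha : a = m
    · subst ha
      rw [hp'm] at hu
      obtain ⟨ν, rfl, hν⟩ := hatt a u hu'
      have := not_prefers_DA ((hunb ν).mp hν)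
      rw [hp'm, ← hσ, hσm] at this
      exact this hu
    · rw [hp'a a ha] at hu
      exact hstable a trivial u hu hu'
  have hne : σ (σ.symm w) ≠ μ (σ.symm w) := by
    intro h
    rw [Equiv.apply_symm_apply] at h
    rw [(Equiv.symm_apply_eq μ).mpr h] at hw
    exact lt_irrefl _ hw
  have ham : σ.symm w ≠ m := fun h => hne (h ▸ hσm)
  -- As `μ` is stable at `p'`, the new partner of `w` prefers her to his partner in `μ`. His list is
  -- the same at `p`, so the two block `μ` there.
  have h1 := not_prefers_DA (m := σ.symm w) fun b _ => hμ' b trivial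
  have h2 := ((p' _).prefers_or_prefers hne).resolve_right h1
  rw [hp'a _ ham, Equiv.apply_symm_apply] at h2
  exact hstable _ trivial _ h2 hw

/-! ### From finite sequences of steps to convergent dynamics. -/

theorem not_exists_pushUpStep {I : Market n} {P : Set (Fin n × Fin n)} {p : Profile n}
    (h : IsNash I P p) : ¬ ∃ p', PushUpStep I P p p' := by
  rintro ⟨p', m, w, q, hP, -, hm, -⟩
  exact h ⟨m, w, q, hP, hm⟩

theorem exists_dynamic {I : Market n} {P : Set (Fin n × Fin n)} {p : Profile n}
    (h : Relation.ReflTransGen (PushUpStep I P) I.men p) (hp : ¬ ∃ p', PushUpStep I P p p') :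
    ∃ s, IsPushUpDynamic I P s ∧ ConvergesTo I P s p := by
  have key : ∀ p₀, Relation.ReflTransGen (PushUpStep I P) p₀ p →
      ∃ s : ℕ → Profile n, s 0 = p₀ ∧ (∀ t, PushUpStep I P (s t) (s (t + 1)) ∨
      ((¬ ∃ p', PushUpStep I P (s t) p') ∧ s (t + 1) = s t)) ∧ ∃ t, s t = p := by
    intro p₀ h
    induction h using Relation.ReflTransGen.head_induction_on with
    | refl => exact ⟨fun _ => p, rfl, fun _ => .inr ⟨hp, rfl⟩, 0, rfl⟩
    | @head a _ hab _ ih =>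
      obtain ⟨s, h0, hs, t, ht⟩ := ih
      refine ⟨fun t => Nat.casesOn t a s, rfl, fun t => ?_, t + 1, ht⟩
      cases t with
      | zero => exact .inl (by simpa [h0] using hab)
      | succ t => exact hs t
  obtain ⟨s, h0, hs, t, ht⟩ := key _ h
  exact ⟨s, ⟨h0, hs⟩, t, ht, hp⟩

end Theory

/-! ### Tables of five-bit digits -/

section Digits

/-- The `k`-th five-bit digit of `T`. -/
def digit (T k : ℕ) : ℕ := (T >>> (5 * k)) % 32

/-- Replace the `k`-th five-bit digit of `T` by `v`. -/
def setDigit (T k v : ℕ) : ℕ := T ^^^ ((digit T k ^^^ (v % 32)) <<< (5 * k))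

theorem testBit_digit (T k i : ℕ) :
    (digit T k).testBit i = (decide (i < 5) && T.testBit (5 * k + i)) := by
  rw [digit, show 32 = 2 ^ 5 from rfl, Nat.testBit_mod_two_pow, Nat.testBit_shiftRight]

/-- The exclusive or cancels the old digit and writes the new one. It acts bit by bit, without
carries, so the other digits are unaffected. -/
theorem digit_setDigit_self (T k v : ℕ) : digit (setDigit T k v) k = v % 32 := by
  refine Nat.eq_of_testBit_eq fun i => ?_
  rw [testBit_digit, setDigit, Nat.testBit_xor, Nat.testBit_shiftLeft, Nat.testBit_xor,
    Nat.add_sub_cancel_left, testBit_digit, show 32 = 2 ^ 5 from rfl, Nat.testBit_mod_two_pow]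
  by_cases h : i < 5 <;> simp [h]

theorem digit_setDigit_of_ne (T v : ℕ) {k j : ℕ} (h : j ≠ k) :
    digit (setDigit T k v) j = digit T j := by
  refine Nat.eq_of_testBit_eq fun i => ?_
  rw [testBit_digit, setDigit, Nat.testBit_xor, Nat.testBit_shiftLeft, Nat.testBit_xor,
    testBit_digit, testBit_digit, show 32 = 2 ^ 5 from rfl, Nat.testBit_mod_two_pow]
  by_cases hi : i < 5
  · by_cases hk : 5 * k ≤ 5 * j + i
    · have : ¬ 5 * j + i - 5 * k < 5 := by omega
      simp [this]
    · simp [hk]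
  · simp [hi]

/-- Apply `f` to the value of `x`; the kernel evaluates `x` first. -/
def force {α : Type} (x : ℕ) (f : ℕ → α) : α :=
  Nat.rec (f 0) (fun k _ => f (Nat.succ k)) x

theorem force_eq {α : Type} (x : ℕ) (f : ℕ → α) : force x f = f x := by
  cases x <;> rfl

/-- Whether `f` holds below `n`. -/
def allBelow (n : ℕ) (f : ℕ → Bool) : Bool :=
  Nat.rec true (fun k b => f k && b) n

theorem of_allBelow {n : ℕ} {f : ℕ → Bool} (h : allBelow n f = true) (k : Fin n) :
    f k = true := by
  obtain ⟨k, hk⟩ := k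
  induction n with
  | zero => omega
  | succ n ih =>
    obtain ⟨h1, h2⟩ := Bool.and_eq_true_iff.mp h
    rcases Nat.lt_succ_iff_lt_or_eq.mp hk with hk' | rfl
    · exact ih h2 hk'
    · exact h1

/-- The number with digits `g 0, …, g (n - 1)`. -/
def pack (g : ℕ → ℕ) (n : ℕ) : ℕ :=
  Nat.rec 0 (fun k T => T + g k <<< (5 * k)) n

/-- The number with digit `k` in place `g k` for `k < n`. -/
def packInverse (g : ℕ → ℕ) (n : ℕ) : ℕ :=
  Nat.rec 0 (fun k T => T + k <<< (5 * g k)) n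

end Digits

/-! ### Verified evaluation -/

section Evaluation

variable {n : ℕ}

/-- `r` gives the ranks in the preference lists of `P`. -/
def Ranks (P : Profile n) (r : ℕ → ℕ → ℕ) : Prop :=
  ∀ a x : Fin n, r a x = (P a).list.idxOf x

theorem Ranks.prefers_iff {P : Profile n} {r : ℕ → ℕ → ℕ} (hr : Ranks P r) {a x y : Fin n} :
    (P a).Prefers x y ↔ r a x < r a y := by
  rw [hr, hr, PrefList.Prefers]

theorem Ranks.injective {P : Profile n} {r : ℕ → ℕ → ℕ} (hr : Ranks P r) {a x y : Fin n}
    (h : r a x = r a y) : x = y := by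
  rw [hr, hr] at h
  exact (List.idxOf_inj ((P a).complete x)).mp h

/-- One step of sequential deferred acceptance, which goes on with `k`. The man `cur` proposes,
the men from `next` on have not yet proposed, `ptr` counts the rejections of each man, and `hold`
has digit `m + 1` in place `w` if `w` holds the proposal of `m`. The man `m` with `i` rejections
proposes to `f m i`. -/
def daStep (n : ℕ) (r f rw : ℕ → ℕ → ℕ) (k : (cur next ptr hold : ℕ) → ℕ)
    (cur next ptr hold : ℕ) : ℕ :=
  force (f cur (digit ptr cur)) fun w => force (digit hold w) fun h =>
    bif Nat.beq h 0 then
      bif Nat.ble n next then ptr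
      else force (setDigit hold w (cur + 1)) fun hold' => k next (next + 1) ptr hold'
    else force (h - 1) fun b =>
      -- These guards verify, from the ranks alone, that both men have been rejected by everyone
      -- above `w`. Soundness therefore depends on neither `f` nor `hold`.
      bif Nat.blt cur n && Nat.blt b n && Nat.blt w n && Nat.beq (r cur w) (digit ptr cur) &&
        Nat.beq (r b w) (digit ptr b) then
        bif Nat.blt (rw w b) (rw w cur) then
          force (setDigit ptr cur (digit ptr cur + 1)) fun ptr' => k cur next ptr' hold
        else bif Nat.blt (rw w cur) (rw w b) then
          force (setDigit ptr b (digit ptr b + 1)) fun ptr' =>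
            force (setDigit hold w (cur + 1)) fun hold' => k b next ptr' hold'
        else ptr
      else ptr

/-- Sequential deferred acceptance; the result is the final value of `ptr`. -/
def daRun (n : ℕ) (r f rw : ℕ → ℕ → ℕ) (fuel : ℕ) : (cur next ptr hold : ℕ) → ℕ :=
  Nat.rec (fun _ _ ptr _ => ptr) (fun _ k => daStep n r f rw k) fuel

theorem daRun_succ (r f rw : ℕ → ℕ → ℕ) (fuel : ℕ) :
    daRun n r f rw (fuel + 1) = daStep n r f rw (daRun n r f rw fuel) := rfl

theorem mem_rejections_of_setDigit {pm pw : Profile n} {r rw : ℕ → ℕ → ℕ} (hr : Ranks pm r)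
    (hrw : Ranks pw rw) {ptr : ℕ}
    (hptr : ∀ a w : Fin n, r a w < digit ptr a → (a, w) ∈ rejections pm pw) {a b w : Fin n}
    (ha : r a w = digit ptr a) (hb : r b w = digit ptr b) (hab : rw w b < rw w a)
    (a' w' : Fin n) (h : r a' w' < digit (setDigit ptr a (digit ptr a + 1)) a') :
    (a', w') ∈ rejections pm pw := by
  by_cases haa : a' = a
  · subst haa
    rw [digit_setDigit_self] at h
    -- Digits are stored modulo 32; an overflow could only lower the count and so claim fewer
    -- rejections.
    have := h.trans_le (Nat.mod_le _ _)
    rcases Nat.lt_succ_iff_lt_or_eq.mp this with h' | h'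
    · exact hptr _ _ h'
    · obtain rfl := hr.injective (h'.trans ha.symm)
      refine mem_rejections_of_prefers (fun v hv => hptr _ _ ?_) (fun v hv => hptr _ _ ?_)
        (hrw.prefers_iff.mpr hab)
      · exact (hr.prefers_iff.mp hv).trans_eq ha
      · exact (hr.prefers_iff.mp hv).trans_eq hb
  · rw [digit_setDigit_of_ne _ _ fun h => haa (Fin.ext h)] at h
    exact hptr _ _ h

/-- The invariant is that all rejections counted in `ptr` are genuine. Since `f` is arbitrary, the
list tables never have to be verified, and too little fuel would only yield fewer rejections. -/
theorem mem_rejections_of_daRun {pm pw : Profile n} {r rw : ℕ → ℕ → ℕ} (hr : Ranks pm r)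
    (hrw : Ranks pw rw) (f : ℕ → ℕ → ℕ) (fuel cur next ptr hold : ℕ)
    (hptr : ∀ a w : Fin n, r a w < digit ptr a → (a, w) ∈ rejections pm pw) (a w : Fin n)
    (h : r a w < digit (daRun n r f rw fuel cur next ptr hold) a) :
    (a, w) ∈ rejections pm pw := by
  induction fuel generalizing cur next ptr hold with
  | zero => exact hptr _ _ h
  | succ fuel ih =>
    simp only [daRun_succ, daStep, force_eq] at h
    generalize f cur (digit ptr cur) = w₀ at h
    generalize digit hold w₀ - 1 = b at h
    rcases hb : Nat.beq (digit hold w₀) 0 with _ | _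
    · rw [hb, cond_false] at h
      rcases hc : (Nat.blt cur n && Nat.blt b n && Nat.blt w₀ n &&
        Nat.beq (r cur w₀) (digit ptr cur) && Nat.beq (r b w₀) (digit ptr b)) with _ | _
      · rw [hc, cond_false] at h
        exact hptr _ _ h
      · rw [hc, cond_true] at h
        simp only [Bool.and_eq_true, Nat.blt_eq, Nat.beq_eq] at hc
        obtain ⟨⟨⟨⟨hcur, hbn⟩, hw⟩, h1⟩, h2⟩ := hc
        rcases h3 : Nat.blt (rw w₀ b) (rw w₀ cur) with _ | _
        · rw [h3, cond_false] at h
          rcases h4 : Nat.blt (rw w₀ cur) (rw w₀ b) with _ | _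
          · rw [h4, cond_false] at h
            exact hptr _ _ h
          · rw [h4, cond_true] at h
            exact ih _ _ _ _ (mem_rejections_of_setDigit hr hrw hptr (a := ⟨b, hbn⟩)
              (b := ⟨cur, hcur⟩) (w := ⟨w₀, hw⟩) h2 h1 (Nat.blt_eq.mp h4)) h
        · rw [h3, cond_true] at h
          exact ih _ _ _ _ (mem_rejections_of_setDigit hr hrw hptr (a := ⟨cur, hcur⟩)
            (b := ⟨b, hbn⟩) (w := ⟨w₀, hw⟩) h1 h2 (Nat.blt_eq.mp h3)) h
    · rw [hb, cond_true] at h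
      rcases hc : Nat.ble n next with _ | _
      · rw [hc, cond_false] at h
        exact ih _ _ _ _ hptr h
      · rw [hc, cond_true] at h
        exact hptr _ _ h

/-- Whether `f` and `g` are mutually inverse on the numbers below `n`. -/
def isMatching (n : ℕ) (f g : ℕ → ℕ) : Bool :=
  allBelow n fun a => Nat.blt (f a) n && Nat.blt (g a) n && Nat.beq (g (f a)) a &&
    Nat.beq (f (g a)) a

theorem isMatching_spec {f g : ℕ → ℕ} (h : isMatching n f g = true) (a : Fin n) :
    f a < n ∧ g a < n ∧ g (f a) = a ∧ f (g a) = a := by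
  have := of_allBelow h a
  simp only [Bool.and_eq_true, Nat.blt_eq, Nat.beq_eq] at this
  tauto

/-- The matching given by a function and its inverse. -/
def matchingOf (f g : ℕ → ℕ) (h : isMatching n f g = true) : Matching n where
  toFun a := ⟨f a, (isMatching_spec h a).1⟩
  invFun w := ⟨g w, (isMatching_spec h w).2.1⟩
  left_inv a := Fin.ext (isMatching_spec h a).2.2.1
  right_inv w := Fin.ext (isMatching_spec h w).2.2.2

/-- Whether no pair with a man other than `m` blocks the matching `f` with inverse `g`. -/
def isUnblocked (n : ℕ) (r rw : ℕ → ℕ → ℕ) (m : ℕ) (f g : ℕ → ℕ) : Bool :=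
  allBelow n fun a => Nat.beq a m || force (r a (f a)) fun k =>
    allBelow n fun w => Nat.ble k (r a w) || Nat.ble (rw w (g w)) (rw w a)

theorem unblockedOn_of_isUnblocked {pm pw : Profile n} {r rw : ℕ → ℕ → ℕ} (hr : Ranks pm r)
    (hrw : Ranks pw rw) {m : ℕ} {f g : ℕ → ℕ} (h : isMatching n f g = true)
    (hu : isUnblocked n r rw m f g = true) :
    UnblockedOn pm pw {a | (a : ℕ) ≠ m} (matchingOf f g h) := by
  intro a ha w h1 h2
  have h3 := of_allBelow hu a
  simp only [Bool.or_eq_true, Nat.beq_eq, force_eq] at h3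
  have h4 := of_allBelow (h3.resolve_left ha) w
  simp only [Bool.or_eq_true, Nat.ble_eq] at h4
  have h1' : r a w < r a (f a) := hr.prefers_iff.mp h1
  have h2' : rw w a < rw w (g w) := hrw.prefers_iff.mp h2
  omega

/-- Whether deferred acceptance results in the matching `f` with inverse `g`. -/
def isOutcome (n : ℕ) (r l rw : ℕ → ℕ → ℕ) (f g : ℕ → ℕ) : Bool :=
  force (daRun n r l rw (n * n) 0 1 0 0) fun ptr =>
    -- The exempted man is given as `n`, who does not exist, so all men are checked for blocking.
    (allBelow n fun a => Nat.ble (r a (f a)) (digit ptr a)) && isUnblocked n r rw n f g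

theorem isStable_of_isUnblocked {pm pw : Profile n} {r rw : ℕ → ℕ → ℕ} (hr : Ranks pm r)
    (hrw : Ranks pw rw) {f g : ℕ → ℕ} (h : isMatching n f g = true)
    (hu : isUnblocked n r rw n f g = true) : IsStable pm pw (matchingOf f g h) :=
  isStable_iff.mpr fun a _ => unblockedOn_of_isUnblocked hr hrw h hu a a.isLt.ne

theorem DA_eq_of_isOutcome {pm pw : Profile n} {r l rw : ℕ → ℕ → ℕ} (hr : Ranks pm r)
    (hrw : Ranks pw rw) {f g : ℕ → ℕ} (h : isMatching n f g = true)
    (ho : isOutcome n r l rw f g = true) : DA pm pw = matchingOf f g h := by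
  rw [isOutcome, force_eq] at ho
  obtain ⟨h1, h2⟩ := Bool.and_eq_true_iff.mp ho
  refine DA_eq_of_rejections (isStable_of_isUnblocked hr hrw h h2) fun a w haw =>
    mem_rejections_of_daRun hr hrw l (n * n) 0 1 0 0 (fun a w h => ?_) a w
      ((hr.prefers_iff.mp haw).trans_le (Nat.ble_eq.mp (of_allBelow h1 a)))
  simp [digit] at h

/-- Whether deferred acceptance matches `m` and `u` if `m` ranks `u` first. The result of the
run is only a candidate: it is verified to be a matching that no other man blocks. -/
def isAttainable (n : ℕ) (r l rw : ℕ → ℕ → ℕ) (m u : ℕ) : Bool :=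
  let l' := fun a k => bif Nat.beq a m then u else l a k
  -- With `m`'s ranks all 0, the guard of `daStep` holds for him only before his first rejection, so
  -- the run stops at his next contested proposal after `u` rejects him.
  force (daRun n (fun a w => bif Nat.beq a m then 0 else r a w) l' rw (n * n) 0 1 0 0) fun ptr =>
    force (pack (fun a => l' a (digit ptr a)) n) fun F =>
      force (packInverse (digit F) n) fun G =>
        Nat.beq (digit F m) u && isMatching n (digit F) (digit G) &&
          isUnblocked n r rw m (digit F) (digit G)

theorem exists_of_isAttainable {pm pw : Profile n} {r l rw : ℕ → ℕ → ℕ} (hr : Ranks pm r)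
    (hrw : Ranks pw rw) {m u : Fin n} (h : isAttainable n r l rw m u = true) :
    ∃ ν : Matching n, ν m = u ∧ UnblockedOn pm pw {m}ᶜ ν := by
  simp only [isAttainable, force_eq, Bool.and_eq_true, Nat.beq_eq] at h
  obtain ⟨⟨h1, h2⟩, h3⟩ := h
  exact ⟨matchingOf _ _ h2, Fin.ext h1, fun a ha => unblockedOn_of_isUnblocked hr hrw h2 h3 a
    fun h => ha (Fin.ext h)⟩

/-- Whether the profile with ranks `r`, lists `l` and outcome `f` is an equilibrium, by the
criterion `isNash_of_attainable`; `rt` are the true ranks. -/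
def isEquilibrium (n : ℕ) (rt r l rw : ℕ → ℕ → ℕ) (f g : ℕ → ℕ) : Bool :=
  allBelow n fun m =>
    (allBelow n fun w => Nat.ble (rt m (f m)) (rt m w) || Nat.blt (r m w) (r m (f m))) &&
    allBelow n fun u => Nat.ble (rw u (g u)) (rw u m) || isAttainable n r l rw m u

theorem isNash_of_isEquilibrium {I : Market n} {p : Profile n} {rt r l rw : ℕ → ℕ → ℕ}
    (hrt : Ranks I.men rt) (hr : Ranks p r) (hrw : Ranks I.women rw) {f g : ℕ → ℕ}
    (h : isMatching n f g = true) (hDA : DA p I.women = matchingOf f g h)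
    (P : Set (Fin n × Fin n)) (he : isEquilibrium n rt r l rw f g = true) : IsNash I P p := by
  refine isNash_of_attainable hDA P (fun m w hmw => ?_) fun m u hmu => ?_
  · have h1 := of_allBelow (Bool.and_eq_true_iff.mp (of_allBelow he m)).1 w
    rw [Bool.or_eq_true, Nat.ble_eq, Nat.blt_eq] at h1
    exact hr.prefers_iff.mpr (h1.resolve_left (not_le.mpr (hrt.prefers_iff.mp hmw)))
  · have h1 := of_allBelow (Bool.and_eq_true_iff.mp (of_allBelow he m)).2 u
    rw [Bool.or_eq_true, Nat.ble_eq] at h1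
    exact exists_of_isAttainable hr hrw
      (h1.resolve_left (not_le.mpr (hrw.prefers_iff.mp hmu)))

end Evaluation

/-! ### Two realizations of the push-up dynamics -/

section Realizations

/-- The preference list obtained from `q` by moving `u` to the top. -/
def PrefList.pushTop {n : ℕ} (q : PrefList n) (u : Fin n) : PrefList n where
  list := u :: q.list.erase u
  nodup := List.nodup_cons.mpr ⟨fun h => ((List.Nodup.mem_erase_iff q.nodup).mp h).1 rfl,
    q.nodup.erase u⟩
  complete x := by
    by_cases h : x = u
    · exact h ▸ List.mem_cons_self
    · exact List.mem_cons_of_mem _ ((List.mem_erase_of_ne h).mpr (q.complete x))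

/-- The profile in which `m` moves `u` to the top of his list. -/
def pushTop {n : ℕ} (p : Profile n) (m u : Fin n) : Profile n :=
  Function.update p m ((p m).pushTop u)

/-! ### Profiles and matchings as natural numbers. -/

/-- The entry in row `a` and column `k` of the table with number `T`; rows have length 32. -/
def entry (T a k : ℕ) : ℕ := digit T (32 * a + k)

/-- The number of the table of the preference lists of `p`. -/
def listNumber (p : Profile 30) : ℕ :=
  (List.finRange 30).foldr
    -- A row of 32 five-bit digits takes 160 bits.
    (fun m T => T <<< 160 + (p m).list.foldr (fun w t => t <<< 5 + w) 0) 0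

/-- The number of the table of the ranks in the preference lists of `p`. -/
def rankNumber (p : Profile 30) : ℕ :=
  (List.finRange 30).foldr
    -- The fold starts from the last woman, so the rank counter `t.1` runs down from 29.
    (fun m T => T <<< 160 + ((p m).list.foldr (fun w t => (t.1 - 1, t.2 + t.1 <<< (5 * w)))
      (29, 0)).2) 0

/-- The ranks in the preference lists of `p`. -/
def rankTable (p : Profile 30) : ℕ → ℕ → ℕ := entry (rankNumber p)

/-- Whether `R` is the number of the table of ranks of `p`. -/
def isRankNumber (p : Profile 30) (R : ℕ) : Bool :=
  decide (∀ a x : Fin 30, entry R a x = (p a).list.idxOf x)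

/-- A matching as a number, from the list of the partners of the men. -/
def partnerTable (l : List ℕ) : ℕ :=
  l.foldr (fun w t => t <<< 5 + w) 0

/-- The partner of the man `m` in the matching with number `N`. -/
def wife (N m : ℕ) : ℕ := digit N m

/-- The partner of the woman `w` in the matching with number `N`. -/
def husband (N w : ℕ) : ℕ := digit (packInverse (digit N) 30) w

/-- The preferences of `p` are tabulated correctly, and deferred acceptance results in the
matching with number `N`. -/
structure HasOutcome (p : Profile 30) (N : ℕ) : Prop where
  ranks : Ranks p (rankTable p)
  isMatching : isMatching 30 (wife N) (husband N) = true
  isOutcome : isOutcome 30 (rankTable p) (entry (listNumber p)) (rankTable market30.women)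
    (wife N) (husband N) = true

theorem ranks_of_isRankNumber {p : Profile 30}
    (h : isRankNumber p (rankNumber p) = true) : Ranks p (rankTable p) :=
  of_decide_eq_true (p := ∀ a x : Fin 30, entry (rankNumber p) a x = (p a).list.idxOf x) h

set_option maxRecDepth 100000 in
theorem ranks_women : Ranks market30.women (rankTable market30.women) :=
  ranks_of_isRankNumber (by decide +kernel)

/-- A verification of `HasOutcome` in which every table is evaluated once. -/
def checkOutcome (p : Profile 30) (N : ℕ) : Bool :=
  force (rankNumber p) fun R => force (listNumber p) fun L =>
    force (rankNumber market30.women) fun K => force N fun F =>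
      force (packInverse (digit F) 30) fun G =>
        isRankNumber p R && isMatching 30 (digit F) (digit G) &&
          isOutcome 30 (entry R) (entry L) (entry K) (digit F) (digit G)

theorem hasOutcome_of_checkOutcome {p : Profile 30} {N : ℕ} (h : checkOutcome p N = true) :
    HasOutcome p N := by
  simp only [checkOutcome, force_eq, Bool.and_eq_true] at h
  exact ⟨ranks_of_isRankNumber h.1.1, h.1.2, h.2⟩

/-- A verification of `IsNash` in which every table is evaluated once. -/
def checkEquilibrium (p : Profile 30) (N : ℕ) : Bool :=
  force (rankNumber market30.men) fun T => force (rankNumber p) fun R =>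
    force (listNumber p) fun L => force (rankNumber market30.women) fun K => force N fun F =>
      force (packInverse (digit F) 30) fun G =>
        isEquilibrium 30 (entry T) (entry R) (entry L) (entry K) (digit F) (digit G)

/-- A verification of `IsStable` in which every table is evaluated once. -/
def checkStable (N : ℕ) : Bool :=
  force (rankNumber market30.men) fun T => force (rankNumber market30.women) fun K =>
    force N fun F => force (packInverse (digit F) 30) fun G =>
      isUnblocked 30 (entry T) (entry K) 30 (digit F) (digit G)

theorem HasOutcome.DA_eq {p : Profile 30} {N : ℕ} (h : HasOutcome p N) :
    DA p market30.women = matchingOf (wife N) (husband N) h.isMatching :=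
  DA_eq_of_isOutcome h.ranks ranks_women h.isMatching h.isOutcome

theorem HasOutcome.DA_val {p : Profile 30} {N : ℕ} (h : HasOutcome p N) (m : Fin 30) :
    (DA p market30.women m : ℕ) = wife N m := by
  rw [h.DA_eq]; rfl

theorem HasOutcome.DA_symm_val {p : Profile 30} {N : ℕ} (h : HasOutcome p N) (w : Fin 30) :
    ((DA p market30.women).symm w : ℕ) = husband N w := by
  rw [h.DA_eq]; rfl

/-- The man keeps his partner `v`, so his condition holds with equality, and `{u}` serves as the
pushed set. With both outcomes known as numbers, the remaining hypotheses can be decided. -/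
theorem pushUpStep_pushTop {p : Profile 30} {N N' : ℕ} {m u v w : Fin 30}
    (h : HasOutcome p N) (h' : HasOutcome (pushTop p m u) N')
    (hv : wife N m = v ∧ wife N' m = v)
    (hup : ((p m).pushTop u).above v = (p m).above v ∪ {u} ∧
      ((p m).pushTop u).below v = (p m).below v \ {u})
    (hw : rankTable market30.women w (husband N' w) < rankTable market30.women w (husband N w)) :
    PushUpStep market30 Set.univ p (pushTop p m u) := by
  have hv₁ : DA p market30.women m = v := Fin.ext ((h.DA_val m).trans hv.1)
  have hv₂ : DA (pushTop p m u) market30.women m = v := Fin.ext ((h'.DA_val m).trans hv.2)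
  refine ⟨m, w, (p m).pushTop u, trivial, ⟨{u}, ?_⟩, ⟨?_, .inr (hv₂.trans hv₁.symm)⟩, rfl⟩
  · rwa [hv₁]
  · rw [ranks_women.prefers_iff, h.DA_symm_val]
    exact (congrArg _ (h'.DA_symm_val w)).trans_lt hw

theorem isNash_of_hasOutcome {p : Profile 30} {N N₀ : ℕ} (h₀ : HasOutcome market30.men N₀)
    (h : HasOutcome p N) (he : checkEquilibrium p N = true) : IsNash market30 Set.univ p := by
  simp only [checkEquilibrium, force_eq] at he
  exact isNash_of_isEquilibrium h₀.ranks h.ranks ranks_women h.isMatching h.DA_eq _ he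

theorem isStable_of_hasOutcome {p : Profile 30} {N N₀ : ℕ} (h₀ : HasOutcome market30.men N₀)
    (h : HasOutcome p N) (hu : checkStable N = true) :
    IsStable market30.men market30.women (DA p market30.women) := by
  simp only [checkStable, force_eq] at hu
  rw [h.DA_eq]
  exact isStable_of_isUnblocked h₀.ranks ranks_women h.isMatching hu

/-! The agents are numbered from 0 here. -/

/-- The outcome of the truthful profile. -/
def partnersTrue : ℕ := partnerTable
  [24, 0, 21, 29, 18, 26, 27, 14, 13, 3, 7, 28, 12, 19, 25,
    15, 8, 20, 23, 22, 1, 9, 16, 11, 2, 6, 4, 5, 10, 17]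

/-- The outcome after the first push-up in either realization. -/
def partnersFirst : ℕ := partnerTable
  [24, 0, 21, 29, 5, 26, 27, 14, 13, 3, 7, 28, 22, 19, 25,
    15, 8, 20, 23, 18, 1, 9, 16, 11, 2, 6, 4, 12, 10, 17]

/-- The final outcome of the first realization. -/
def partnersA : ℕ := partnerTable
  [24, 8, 21, 29, 5, 26, 27, 14, 13, 3, 9, 25, 22, 19, 7,
    15, 0, 28, 23, 18, 1, 4, 16, 11, 20, 6, 2, 12, 10, 17]

/-- The outcome after two push-ups in the second realization. -/
def partnersB₂ : ℕ := partnerTable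
  [24, 8, 21, 29, 5, 26, 27, 14, 13, 3, 7, 28, 22, 19, 25,
    15, 0, 20, 23, 18, 1, 9, 16, 11, 2, 6, 4, 12, 10, 17]

/-- The final outcome of the second realization. -/
def partnersB : ℕ := partnerTable
  [24, 8, 21, 29, 5, 26, 27, 14, 13, 3, 9, 28, 22, 19, 7,
    15, 0, 20, 23, 18, 1, 25, 16, 11, 2, 6, 4, 12, 10, 17]

/-- The first push-up of the first realization. -/
def profileA₁ : Profile 30 := pushTop market30.men 8 22

/-- The end of the first realization. -/
def profileA : Profile 30 := pushTop profileA₁ 20 4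

/-- The first push-up of the second realization. -/
def profileB₁ : Profile 30 := pushTop market30.men 14 22

/-- The second push-up of the second realization. -/
def profileB₂ : Profile 30 := pushTop profileB₁ 26 8

/-- The end of the second realization. -/
def profileB : Profile 30 := pushTop profileB₂ 23 9

set_option maxRecDepth 100000 in
theorem hasOutcome_true : HasOutcome market30.men partnersTrue :=
  hasOutcome_of_checkOutcome (by decide +kernel)

set_option maxRecDepth 100000 in
theorem hasOutcome_A₁ : HasOutcome profileA₁ partnersFirst :=
  hasOutcome_of_checkOutcome (by decide +kernel)

set_option maxRecDepth 100000 in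
theorem hasOutcome_A : HasOutcome profileA partnersA :=
  hasOutcome_of_checkOutcome (by decide +kernel)

set_option maxRecDepth 100000 in
theorem hasOutcome_B₁ : HasOutcome profileB₁ partnersFirst :=
  hasOutcome_of_checkOutcome (by decide +kernel)

set_option maxRecDepth 100000 in
theorem hasOutcome_B₂ : HasOutcome profileB₂ partnersB₂ :=
  hasOutcome_of_checkOutcome (by decide +kernel)

set_option maxRecDepth 100000 in
theorem hasOutcome_B : HasOutcome profileB partnersB :=
  hasOutcome_of_checkOutcome (by decide +kernel)

theorem step_A₁ : PushUpStep market30 Set.univ market30.men profileA₁ :=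
  pushUpStep_pushTop (v := 13) (w := 5) hasOutcome_true hasOutcome_A₁
    (by decide +kernel) (by decide +kernel) (by decide +kernel)

theorem step_A : PushUpStep market30 Set.univ profileA₁ profileA :=
  pushUpStep_pushTop (v := 1) (w := 0) hasOutcome_A₁ hasOutcome_A
    (by decide +kernel) (by decide +kernel) (by decide +kernel)

theorem step_B₁ : PushUpStep market30 Set.univ market30.men profileB₁ :=
  pushUpStep_pushTop (v := 25) (w := 5) hasOutcome_true hasOutcome_B₁
    (by decide +kernel) (by decide +kernel) (by decide +kernel)

theorem step_B₂ : PushUpStep market30 Set.univ profileB₁ profileB₂ :=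
  pushUpStep_pushTop (v := 4) (w := 0) hasOutcome_B₁ hasOutcome_B₂
    (by decide +kernel) (by decide +kernel) (by decide +kernel)

theorem step_B : PushUpStep market30 Set.univ profileB₂ profileB :=
  pushUpStep_pushTop (v := 11) (w := 7) hasOutcome_B₂ hasOutcome_B
    (by decide +kernel) (by decide +kernel) (by decide +kernel)

set_option maxRecDepth 100000 in
theorem isNash_A : IsNash market30 Set.univ profileA :=
  isNash_of_hasOutcome hasOutcome_true hasOutcome_A (by decide +kernel)

set_option maxRecDepth 100000 in
theorem isStable_A :
    IsStable market30.men market30.women (DA profileA market30.women) :=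
  isStable_of_hasOutcome hasOutcome_true hasOutcome_A (by decide +kernel)

set_option maxRecDepth 100000 in
theorem isNash_B : IsNash market30 Set.univ profileB :=
  isNash_of_hasOutcome hasOutcome_true hasOutcome_B (by decide +kernel)

set_option maxRecDepth 100000 in
theorem isStable_B :
    IsStable market30.men market30.women (DA profileB market30.women) :=
  isStable_of_hasOutcome hasOutcome_true hasOutcome_B (by decide +kernel)

theorem DA_A_ne_DA_B : DA profileA market30.women ≠ DA profileB market30.women := by
  intro h
  -- Counting from 0, man 11 is matched to woman 25 at `profileA` and to woman 28 at `profileB`.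
  have h' := congrArg (fun μ : Matching 30 => (μ 11 : ℕ)) h
  simp only [hasOutcome_A.DA_val, hasOutcome_B.DA_val] at h'
  revert h'
  decide +kernel

end Realizations
end MatchingGame

/-- In the instance `market30` with every man-woman pair strategic, two realizations of the
push-up dynamics converge to different Nash equilibria, whose deferred acceptance matchings are
distinct and both stable with respect to the true preferences. -/
theorem mainTheorem8 :
    ∃ (s s' : ℕ → MatchingGame.Profile 30) (p p' : MatchingGame.Profile 30),
      MatchingGame.IsPushUpDynamic MatchingGame.market30 Set.univ s ∧
      MatchingGame.IsPushUpDynamic MatchingGame.market30 Set.univ s' ∧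
      MatchingGame.ConvergesTo MatchingGame.market30 Set.univ s p ∧
      MatchingGame.ConvergesTo MatchingGame.market30 Set.univ s' p' ∧
      MatchingGame.IsNash MatchingGame.market30 Set.univ p ∧
      MatchingGame.IsNash MatchingGame.market30 Set.univ p' ∧
      p ≠ p' ∧
      MatchingGame.IsStable MatchingGame.market30.men MatchingGame.market30.women
        (MatchingGame.DA p MatchingGame.market30.women) ∧
      MatchingGame.IsStable MatchingGame.market30.men MatchingGame.market30.women
        (MatchingGame.DA p' MatchingGame.market30.women) ∧
      MatchingGame.DA p MatchingGame.market30.women ≠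
        MatchingGame.DA p' MatchingGame.market30.women := by
  obtain ⟨s, hs, hsp⟩ := MatchingGame.exists_dynamic
    (.head MatchingGame.step_A₁ (.single MatchingGame.step_A))
    (MatchingGame.not_exists_pushUpStep MatchingGame.isNash_A)
  obtain ⟨s', hs', hsp'⟩ := MatchingGame.exists_dynamic
    (.head MatchingGame.step_B₁ (.head MatchingGame.step_B₂ (.single MatchingGame.step_B)))
    (MatchingGame.not_exists_pushUpStep MatchingGame.isNash_B)
  exact ⟨s, s', MatchingGame.profileA, MatchingGame.profileB, hs, hs', hsp, hsp',
    MatchingGame.isNash_A, MatchingGame.isNash_B,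
    fun h => MatchingGame.DA_A_ne_DA_B
      (congrArg (MatchingGame.DA · MatchingGame.market30.women) h),
    MatchingGame.isStable_A, MatchingGame.isStable_B, MatchingGame.DA_A_ne_DA_B⟩
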